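/- **Conventions.** SZH-diagrams have wires of sizes $k\in\mathbb N$; a wire of size $k$ is interpreted as $\mathbb C^{2^k}$ with basis $|x\rangle$, $x\in\{0,1\}^k$. Diagrams are interpreted as linear maps with the well-tempered semantics: an h-box of size $k$ with $p$ inputs, $q$ outputs and parameter $c\in\mathbb C^k$ is $2^{-k(p+q)/4}\sum_{x_1,\dots,x_{p+q}\in\{0,1\}^k}\prod_{j=1}^k c_j^{\,x_{1,j}\wedge\dots\wedge x_{p+q,j}}\,|x_{p+1}\cdots x_{p+q}\rangle\langle x_1\cdots x_p|$, and the (yellow) arrow labelled by a Boolean $q\times p$ matrix $A$ is $|x\rangle\mapsto 2^{(q-p)/4}|A x\rangle$, where $(Ax)_i=\bigwedge_{j:A_{ij}=1}x_j$. An equation of diagrams holds if both sides have the same interpretation, scalars included. Products of matrices are over the Boolean semiring $(\vee,\wedge)$. **Theorem (Fourier hyper pivot, scalable version).** Let $A$ be a Boolean $n\times a$ matrix, $B$ a Boolean $m\times b$ matrix, $\lambda\in(\mathbb C\setminus\{0\})^n$, and fix a square root $\lambda_i^{1/2}$ of each $\lambda_i$. Number the positions of a word of length $nm$ as $m$ successive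 blocks of length $n$. Let $\overrightarrow{I_n}$ be the $nm\times n$ matrix whose row at position $i$ of block $j$ selects column $i$, let $\overrightarrow{I_m}$ be the $nm\times m$ matrix whose row at that position selects column $j$, let $\Delta_{nm}$ be the $2^{nm}\times nm$ matrix with $(\Delta_{nm})_{s,p}=1$ iff $p\in s$, and put $$C=\Delta_{nm}\cdot\overrightarrow{I_n}\cdot A,\qquad D=\Delta_{nm}\cdot\overrightarrow{I_m}\cdot B .$$ Let $\overrightarrow{\{i\}}\in\{0,1\}^{nm}$ consist of $m$ copies of the word of length $n$ whose only $1$ is at position $i$, and for $s\in\{0,1\}^{nm}$ of weight $|s|$ put $$\mu_\emptyset=\prod_i\lambda_i^{-1/2},\qquad \mu_s=\begin{cases}\lambda_i^{(-2)^{|s|-1}}&\text{if } s\le\overrightarrow{\{i\}},\\ 1&\text{if there is no such } i\end{cases}\qquad(s\neq\emptyset).$$ 1. The following two diagrams, with two inputs of sizes $a$ and $b$ and no output, are equal. * Left-hand side: the scalar $\mu_\emptyset$ (an h-box without legs) next to the following diagram $P_\lambda$. A Hadamard box (the two-legged h-box of parameter $-1$) joins two thin wires $u$ and $v$. The wire $u$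 goes through the all-ones arrow $1\to n$ into a two-legged h-box of size $n$ and parameter $\lambda$, whose other leg is the output of the arrow $A$ on the first input. The wire $v$ goes through the all-ones arrow $1\to m$ into a two-legged h-box of size $m$ with all parameters $-1$, whose other leg is the output of the arrow $B$ on the second input. * Right-hand side: the arrows $C$ on the first input and $D$ on the second input meet at a two-legged h-box of size $2^{nm}$ and parameter $\mu$. 2. This contains the regular hyper pivot. Let $R$ be the diagram in which the arrows $\overrightarrow{I_n}\cdot A$ and $\overrightarrow{I_m}\cdot B$ meet at a two-legged h-box of size $nm$ with all parameters $-1$. When all $\lambda_i=-1$, the right-hand side of 1 equals the scalar $\mu_\emptyset$ next to $R$; and $P_{(-1,\dots,-1)}=R$. -/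

import Mathlib

namespace SZH

/-- A bit word of length `k`; basis vectors of a wire of size `k`. -/
abbrev Bits (k : ℕ) : Type := Fin k → Bool

/-- Basis vectors of the space interpreting the type `(k₁) + ⋯ + (k_r)`, given as the list of
its wire sizes: one word of length `k` for each wire of size `k`. -/
def Word : List ℕ → Type
  | [] => Unit
  | k :: t => Bits k × Word t

instance Word.instFintype : (t : List ℕ) → Fintype (Word t)
  | [] => inferInstanceAs (Fintype Unit)
  | k :: t =>
    letI := Word.instFintype t
    inferInstanceAs (Fintype (Bits k × Word t))

instance Word.instDecidableEq : (t : List ℕ) → DecidableEq (Word t)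
  | [] => inferInstanceAs (DecidableEq Unit)
  | k :: t =>
    letI := Word.instDecidableEq t
    inferInstanceAs (DecidableEq (Bits k × Word t))

/-- The part of a word on `t ++ u` that lives on the wires `t`. -/
def Word.left : (t u : List ℕ) → Word (t ++ u) → Word t
  | [], _, _ => ()
  | _ :: t, u, w => (w.1, Word.left t u w.2)

/-- The part of a word on `t ++ u` that lives on the wires `u`. -/
def Word.right : (t u : List ℕ) → Word (t ++ u) → Word u
  | [], _, w => w
  | _ :: t, u, w => Word.right t u w.2

/-- The words on the individual legs of a bundle of `n` wires of size `k`. -/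
def Word.legs {k : ℕ} : (n : ℕ) → Word (List.replicate n k) → Fin n → Bits k
  | 0, _ => Fin.elim0
  | n + 1, w => Fin.cons (α := fun _ => Bits k) w.1 (Word.legs n w.2)

/-- Boolean matrices with `m` rows and `n` columns. -/
abbrev BMat (m n : ℕ) : Type := Matrix (Fin m) (Fin n) Bool

/-- Product of Boolean matrices over the Boolean semiring (`+` is `∨`, `×` is `∧`). -/
def BMat.mul {l m n : ℕ} (B : BMat l m) (A : BMat m n) : BMat l n :=
  fun i k => decide (∃ j, B i j = true ∧ A j k = true)

/-- The matrix full of ones. -/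
def BMat.ones (m n : ℕ) : BMat m n := fun _ _ => true

/-- Diagrams of the SZH-calculus, from an input type to an output type. The generators are
the identity wires, symmetries, cups, caps, dividers, gatherers, scaled green spiders with a
vector of phases, scaled h-boxes with a vector of complex parameters, red arrows and yellow
arrows; `seq f g` plugs the outputs of `f` into the inputs of `g`, and `par` juxtaposes. -/
inductive Diagram : List ℕ → List ℕ → Type
  | id (t : List ℕ) : Diagram t t
  | swap (k l : ℕ) : Diagram [k, l] [l, k]
  | cup (k : ℕ) : Diagram [] [k, k]
  | cap (k : ℕ) : Diagram [k, k] []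
  | divider (k : ℕ) : Diagram [k + 1] [1, k]
  | gatherer (k : ℕ) : Diagram [1, k] [k + 1]
  | green (k n m : ℕ) (phase : Fin k → ℝ) :
      Diagram (List.replicate n k) (List.replicate m k)
  | hbox (k n m : ℕ) (param : Fin k → ℂ) :
      Diagram (List.replicate n k) (List.replicate m k)
  | red {m n : ℕ} (A : BMat m n) : Diagram [n] [m]
  | yellow {m n : ℕ} (A : BMat m n) : Diagram [n] [m]
  | seq {t u v : List ℕ} (f : Diagram t u) (g : Diagram u v) : Diagram t v
  | par {t u t' u' : List ℕ} (f : Diagram t u) (g : Diagram t' u') :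
      Diagram (t ++ t') (u ++ u')

/-- The complex number `2 ^ q` for a real exponent `q`. -/
noncomputable def twoPow (q : ℝ) : ℂ := (((2 : ℝ) ^ q : ℝ) : ℂ)

/-- The word obtained from `x` by the red arrow of `A`: the product over the field with two
elements, so that bit `i` is the sum modulo two of the bits of `x` selected by row `i`. -/
def redMap {m n : ℕ} (A : BMat m n) (x : Bits n) : Bits m :=
  fun i => decide (Odd (Finset.univ.filter fun j => A i j = true ∧ x j = true).card)

/-- The word obtained from `x` by the yellow arrow of `A`, that is, by the bipartite graph in
which every input is copied by a green spider and every output is an h-box of parameter `-1`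
followed by a Hadamard box: bit `i` is the conjunction of the bits of `x` selected by row
`i`. -/
def yellowMap {m n : ℕ} (A : BMat m n) (x : Bits n) : Bits m :=
  fun i => decide (∀ j, A i j = true → x j = true)

/-- The standard (well-tempered) interpretation of a diagram: the matrix of a linear map, with
the column of an input basis vector `x` and the row of an output basis vector `y`. -/
noncomputable def Diagram.interp : {t u : List ℕ} → Diagram t u → Matrix (Word u) (Word t) ℂ
  | _, _, .id _ => fun y x => if y = x then 1 else 0
  | _, _, .swap _ _ => fun y x => if y.1 = x.2.1 ∧ y.2.1 = x.1 then 1 else 0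
  | _, _, .cup _ => fun y _ => if y.1 = y.2.1 then 1 else 0
  | _, _, .cap _ => fun _ x => if x.1 = x.2.1 then 1 else 0
  | _, _, .divider k => fun y x =>
      if x.1 = Fin.cons (α := fun _ => Bool) (y.1 0) (y.2.1 : Bits k) then 1 else 0
  | _, _, .gatherer k => fun y x =>
      if y.1 = Fin.cons (α := fun _ => Bool) (x.1 0) (x.2.1 : Bits k) then 1 else 0
  | _, _, .green k n m phase => fun y x =>
      twoPow ((k : ℝ) * ((n : ℝ) + (m : ℝ) - 2) / 4) *
        ∑ z : Bits k,
          if (∀ i, Word.legs m y i = z) ∧ (∀ i, Word.legs n x i = z) then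
            Complex.exp (Complex.I * ((∑ j, if z j = true then phase j else 0 : ℝ) : ℂ))
          else 0
  | _, _, .hbox k n m param => fun y x =>
      twoPow (-((k : ℝ) * ((n : ℝ) + (m : ℝ)) / 4)) *
        ∏ j : Fin k,
          if (∀ i, Word.legs m y i j = true) ∧ (∀ i, Word.legs n x i j = true) then param j
          else 1
  | _, _, .red (m := m) (n := n) A => fun y x =>
      if y.1 = redMap A x.1 then twoPow (((m : ℝ) - (n : ℝ)) / 4) else 0
  | _, _, .yellow (m := m) (n := n) A => fun y x =>
      if y.1 = yellowMap A x.1 then twoPow (((m : ℝ) - (n : ℝ)) / 4) else 0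
  | _, _, .seq f g => g.interp * f.interp
  | _, _, .par (t := t) (u := u) (t' := t') (u' := u') f g => fun y x =>
      f.interp (Word.left u u' y) (Word.left t t' x) *
        g.interp (Word.right u u' y) (Word.right t t' x)

/-- Two diagrams are equal in the calculus when they represent the same linear map, scalars
included. -/
def Diagram.Equal {t u : List ℕ} (f g : Diagram t u) : Prop := f.interp = g.interp

/-- The Boolean word of length `k` numbered by `s`: the binary digits of `s`. It is also read
as a subset of the positions. -/
def subsetWord {k : ℕ} (s : Fin (2 ^ k)) : Bits k :=
  fun i => decide (finFunctionFinEquiv.symm s i = (1 : Fin 2))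

/-- The Hamming weight of a word. -/
def weight {k : ℕ} (x : Bits k) : ℕ := (Finset.univ.filter fun i => x i = true).card

/-- The matrix `Δ_k` with `2 ^ k` rows, whose entry at `(s, i)` says whether `i ∈ s`. -/
def Delta (k : ℕ) : BMat (2 ^ k) k := fun s i => subsetWord s i

/-- The identity matrix `I_n` copied `m` times. The positions in `Fin (m * n)` form `m`
successive blocks of length `n`; position number `i` of any block selects column `i`. -/
def copiesI (m n : ℕ) : BMat (m * n) n := fun p i => decide (p.modNat = i)

/-- The identity matrix `I_m` copied `n` times, on the same positions: each position of block
number `j` selects column `j`. -/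
def copiesJ (m n : ℕ) : BMat (m * n) m := fun p j => decide (p.divNat = j)

/-- `m` copies of the word of length `n` whose only one is at position `i`. -/
def blockWord (m : ℕ) {n : ℕ} (i : Fin n) : Bits (m * n) := fun p => decide (p.modNat = i)

/-- The matrix `C = Δ_{nm} · I_n · A`. -/
def matC {a n : ℕ} (m : ℕ) (A : BMat n a) : BMat (2 ^ (m * n)) a :=
  ((Delta (m * n)).mul (copiesI m n)).mul A

/-- The matrix `D = Δ_{nm} · I_m · B`. -/
def matD {b m : ℕ} (n : ℕ) (B : BMat m b) : BMat (2 ^ (m * n)) b :=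
  ((Delta (m * n)).mul (copiesJ m n)).mul B

/-- The scalar `μ_∅ = ∏ λ_i ^ (-1/2)`, where `rho i` is the chosen square root of `λ_i`. -/
noncomputable def muEmpty {n : ℕ} (rho : Fin n → ℂ) : ℂ := ∏ i, (rho i)⁻¹

/-- The parameters `μ_s`: `μ_∅` is as above and, for nonempty `s`, `μ_s` is
`λ_i ^ ((-2) ^ (|s| - 1))` if `s ≤ blockWord m i` and `1` if there is no such `i`. A nonempty
`s` lies below at most one of the words `blockWord m i`, so the product has at most one factor
different from `1`. -/
noncomputable def mu {n : ℕ} (m : ℕ) (lam rho : Fin n → ℂ) (s : Fin (2 ^ (m * n))) : ℂ :=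
  if weight (subsetWord s) = 0 then muEmpty rho
  else ∏ i : Fin n,
    if ∀ p, subsetWord s p = true → blockWord m i p = true then
      lam i ^ ((-2 : ℤ) ^ (weight (subsetWord s) - 1))
    else 1

/-- The h-box without legs and with parameter `c`, which is the scalar `c`. -/
def scalarBox (c : ℂ) : Diagram [] [] := .hbox 1 0 0 (fun _ => c)

/-- The pattern that the hyper pivot eliminates. Two thin wires `u`, `v` are joined by a
Hadamard box. Then `u` is copied to the `n` thin wires of a thick wire by an arrow full of
ones, which meets the yellow arrow of `A` at the scaled h-box of parameter `lam`; and `v` is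
copied `m` times and meets the yellow arrow of `B` at the scaled h-box of parameter `-1`. -/
def pivotLhs {a b n m : ℕ} (A : BMat n a) (B : BMat m b) (lam : Fin n → ℂ) :
    Diagram [a, b] [] :=
  .seq
    (.par (.id [a]) (.par (.hbox 1 0 2 (fun _ => -1)) (.id [b])) :
      Diagram [a, b] [a, 1, 1, b])
    (.seq
      (.par (.yellow A)
        (.par (.yellow (BMat.ones n 1)) (.par (.yellow (BMat.ones m 1)) (.yellow B))) :
        Diagram [a, 1, 1, b] [n, n, m, m])
      (.par (.hbox n 2 0 lam) (.hbox m 2 0 (fun _ => -1)) : Diagram [n, n, m, m] []))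

/-- Two yellow arrows meeting at a scaled h-box of parameter `param`. -/
def arrowsBox {a b k : ℕ} (C : BMat k a) (D : BMat k b) (param : Fin k → ℂ) :
    Diagram [a, b] [] :=
  .seq (.par (.yellow C) (.yellow D) : Diagram [a, b] [k, k])
    (.hbox k 2 0 param : Diagram [k, k] [])

/-- Left-hand side of the Fourier hyper pivot: the pivot pattern with parameters `lam`, and
the scalar `μ_∅`. -/
noncomputable def fourierLhs {a b n m : ℕ} (A : BMat n a) (B : BMat m b)
    (lam rho : Fin n → ℂ) : Diagram [a, b] [] :=
  .par (scalarBox (muEmpty rho)) (pivotLhs A B lam)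

/-- Right-hand side of the Fourier hyper pivot: the arrows `C` and `D` meet at the scaled h-box
of parameter `μ`. -/
noncomputable def fourierRhs {a b n m : ℕ} (A : BMat n a) (B : BMat m b)
    (lam rho : Fin n → ℂ) : Diagram [a, b] [] :=
  arrowsBox (matC m A) (matD n B) (mu m lam rho)

/-- Right-hand side of the regular hyper pivot: one h-box of parameter `-1` for each pair of a
row of `A` and a row of `B`. -/
def regularRhs {a b n m : ℕ} (A : BMat n a) (B : BMat m b) : Diagram [a, b] [] :=
  arrowsBox ((copiesI m n).mul A) ((copiesJ m n).mul B) (fun _ => -1)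

end SZH

namespace SZH

/-! Evaluate both sides on a basis vector and let `u`, `v` be the words produced by the arrows of
`A` and `B`. Summing over the two thin wires turns the pivot into `∏ λ_i` over the `i` with `u i =
true` if `weight v` is odd, and into `1` if it is even (`interp_pivotLhs`). On the other side, row
`s` of `Δ` fires exactly when `s` lies in the set `T` of positions where both copied words are true.
The empty set always fires and gives `μ_∅`; a nonempty `s` matters only inside one fibre `p.modNat =
i`, which meets `T` in `weight v` points if `u i` holds and in none otherwise. The exponents of
`λ_i` then add up, over the nonempty subsets of a set of size `k`, to `(1 - (-1)^k)/2`, the parity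
of `k` (`sum_neg_two_pow_card_erase_empty`, `prod_mu`). -/

/-! ### Evaluation of the diagrams on basis vectors. -/

lemma sum_word_nil (f : Word [] → ℂ) : ∑ w, f w = f () :=
  Fintype.sum_unique (ι := Unit) f

lemma sum_word_cons {k : ℕ} {t : List ℕ} (f : Word (k :: t) → ℂ) :
    ∑ w, f w = ∑ x : Bits k, ∑ w : Word t, f (x, w) :=
  Fintype.sum_prod_type (α₁ := Bits k) (α₂ := Word t) f

lemma sum_bits_one (f : Bits 1 → ℂ) :
    ∑ u, f u = f (fun _ => true) + f (fun _ => false) := by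
  rw [← (Equiv.funUnique (Fin 1) Bool).symm.sum_comp f, Fintype.sum_bool]
  rfl

lemma twoPow_add (p q : ℝ) : twoPow (p + q) = twoPow p * twoPow q := by
  simp [twoPow, Real.rpow_add]

lemma twoPow_zero : twoPow 0 = 1 := by simp [twoPow]

lemma twoPow_neg_one : twoPow (-1) * 2 = 1 := by
  simp [twoPow, Real.rpow_neg_one]

lemma interp_scalarBox (c : ℂ) (y x : Word []) : (scalarBox c).interp y x = c := by
  simp [scalarBox, Diagram.interp, twoPow_zero]

lemma interp_scalarBox_par {t : List ℕ} (c : ℂ) (f : Diagram t []) (y : Word [])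
    (x : Word t) : (Diagram.par (scalarBox c) f).interp y x = c * f.interp y x := by
  change (scalarBox c).interp _ _ * f.interp _ _ = _
  rw [interp_scalarBox]
  rfl

lemma interp_hbox_two_zero {k : ℕ} (c : Fin k → ℂ) (y : Word []) (x : Word [k, k]) :
    (Diagram.hbox k 2 0 c).interp y x =
      twoPow (-((k : ℝ) / 2)) *
        ∏ j, if x.1 j = true ∧ x.2.1 j = true then c j else 1 := by
  have h : -((k : ℝ) * (((2 : ℕ) : ℝ) + ((0 : ℕ) : ℝ)) / 4) = -((k : ℝ) / 2) := by
    push_cast; ring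
  change twoPow (-((k : ℝ) * (((2 : ℕ) : ℝ) + ((0 : ℕ) : ℝ)) / 4)) * _ = _
  rw [h]
  congr 1
  refine Finset.prod_congr rfl fun j _ => ?_
  simp only [Fin.forall_fin_two, IsEmpty.forall_iff, true_and]
  rfl

lemma interp_hbox_zero_two {k : ℕ} (c : Fin k → ℂ) (y : Word [k, k]) (x : Word []) :
    (Diagram.hbox k 0 2 c).interp y x =
      twoPow (-((k : ℝ) / 2)) *
        ∏ j, if y.1 j = true ∧ y.2.1 j = true then c j else 1 := by
  have h : -((k : ℝ) * (((0 : ℕ) : ℝ) + ((2 : ℕ) : ℝ)) / 4) = -((k : ℝ) / 2) := by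
    push_cast; ring
  change twoPow (-((k : ℝ) * (((0 : ℕ) : ℝ) + ((2 : ℕ) : ℝ)) / 4)) * _ = _
  rw [h]
  congr 1
  refine Finset.prod_congr rfl fun j _ => ?_
  simp only [Fin.forall_fin_two, IsEmpty.forall_iff, and_true]
  rfl

lemma interp_arrowsBox {a b k : ℕ} (C : BMat k a) (D : BMat k b) (c : Fin k → ℂ)
    (y : Word []) (x : Word [a, b]) :
    (arrowsBox C D c).interp y x =
      twoPow (-(((a : ℝ) + b) / 4)) *
        ∏ j, if yellowMap C x.1 j = true ∧ yellowMap D x.2.1 j = true then c j else 1 := by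
  have h : -(((a : ℝ) + b) / 4) =
      -((k : ℝ) / 2) + (((k : ℝ) - a) / 4 + ((k : ℝ) - b) / 4) := by ring
  -- Each arrow is a function on basis vectors, so a single `w` survives in the matrix product.
  change ∑ w : Word [k, k], (Diagram.hbox k 2 0 c).interp y w *
    ((if w.1 = yellowMap C x.1 then twoPow (((k : ℝ) - a) / 4) else 0) *
      (if w.2.1 = yellowMap D x.2.1 then twoPow (((k : ℝ) - b) / 4) else 0)) = _
  simp only [sum_word_cons, sum_word_nil, interp_hbox_two_zero, ite_mul, mul_ite,
    zero_mul, mul_zero, Finset.sum_ite_eq', Finset.mem_univ, if_true,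
    Finset.sum_ite_irrel, Finset.sum_const_zero]
  rw [h, twoPow_add, twoPow_add]
  ring

lemma yellowMap_ones {n : ℕ} (c : Bool) :
    yellowMap (BMat.ones n 1) (fun _ => c) = fun _ => c := by
  funext i
  simp [yellowMap, BMat.ones]

lemma prod_neg_one_of_bits {k : ℕ} (v : Bits k) :
    (∏ j, if v j = true then (-1 : ℂ) else 1) = (-1) ^ weight v := by
  rw [Finset.prod_ite, Finset.prod_const, Finset.prod_const_one, mul_one, weight]

lemma interp_id_singleton {k : ℕ} (y x : Word [k]) :
    (Diagram.id [k]).interp y x = if y.1 = x.1 then 1 else 0 :=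
  if_congr ⟨congrArg Prod.fst, fun h => Prod.ext h rfl⟩ rfl rfl

/-- With `L` the product of the `lam i` selected by `A` and `k` the weight of the word from `B`, the
four values of the thin wires sum to `1 + (-1)^k + L (1 - (-1)^k)`, which is `2` or `2 L`. -/
lemma interp_pivotLhs {a b n m : ℕ} (A : BMat n a) (B : BMat m b) (lam : Fin n → ℂ)
    (y : Word []) (x : Word [a, b]) :
    (pivotLhs A B lam).interp y x =
      twoPow (-(((a : ℝ) + b) / 4)) *
        ∏ i, if yellowMap A x.1 i = true ∧ Odd (weight (yellowMap B x.2.1)) then lam i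
          else 1 := by
  have key : (pivotLhs A B lam).interp y x =
      ∑ w : Word [a, 1, 1, b],
        (∑ z : Word [n, n, m, m],
          ((twoPow (-((n : ℝ) / 2)) *
              ∏ j, if z.1 j = true ∧ z.2.1 j = true then lam j else 1) *
            (twoPow (-((m : ℝ) / 2)) *
              ∏ j, if z.2.2.1 j = true ∧ z.2.2.2.1 j = true then -1 else 1)) *
          ((if z.1 = yellowMap A w.1 then twoPow (((n : ℝ) - a) / 4) else 0) *
            ((if z.2.1 = yellowMap (BMat.ones n 1) w.2.1
                then twoPow (((n : ℝ) - (1 : ℕ)) / 4) else 0) *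
              ((if z.2.2.1 = yellowMap (BMat.ones m 1) w.2.2.1
                  then twoPow (((m : ℝ) - (1 : ℕ)) / 4) else 0) *
                (if z.2.2.2.1 = yellowMap B w.2.2.2.1
                  then twoPow (((m : ℝ) - b) / 4) else 0))))) *
        ((if w.1 = x.1 then 1 else 0) *
          ((twoPow (-(((1 : ℕ) : ℝ) / 2)) *
              ∏ j, if w.2.1 j = true ∧ w.2.2.1 j = true then -1 else 1) *
            (if w.2.2.2.1 = x.2.1 then 1 else 0))) :=
    Finset.sum_congr rfl fun w _ => congrArg₂ (· * ·)
      (Finset.sum_congr rfl fun z _ => congrArg₂ (· * ·)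
        (congrArg₂ (· * ·)
          (interp_hbox_two_zero lam _ (Word.left [n, n] [m, m] z))
          (interp_hbox_two_zero _ _ (Word.right [n, n] [m, m] z))) rfl)
      (congrArg₂ (· * ·)
        (interp_id_singleton (Word.left [a] [1, 1, b] w) (Word.left [a] [b] x))
        (congrArg₂ (· * ·)
          (interp_hbox_zero_two _
            (Word.left [1, 1] [b] (Word.right [a] [1, 1, b] w)) ())
          (interp_id_singleton (Word.right [1, 1] [b] (Word.right [a] [1, 1, b] w))
            (Word.right [a] [b] x))))
  rw [key]
  simp only [sum_word_cons, sum_word_nil, ite_mul,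
    mul_ite, zero_mul, mul_zero, Finset.sum_ite_eq', Finset.mem_univ, if_true,
    Finset.sum_ite_irrel, Finset.sum_const_zero, mul_one]
  simp only [sum_bits_one, yellowMap_ones]
  simp only [Fin.prod_univ_one, and_true, and_false, if_true, if_false, Bool.false_eq_true,
    Finset.prod_const_one, prod_neg_one_of_bits, true_and, false_and]
  -- The normalisations of the generators multiply to `2^(-(a+b)/4 - 1)`; the last factor `2` is the
  -- one left by the thin-wire sum.
  have h : twoPow (-(((a : ℝ) + b) / 4)) = twoPow (-((n : ℝ) / 2)) * twoPow (-((m : ℝ) / 2)) *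
      twoPow (((n : ℝ) - a) / 4) * twoPow (((n : ℝ) - (1 : ℕ)) / 4) *
      twoPow (((m : ℝ) - (1 : ℕ)) / 4) * twoPow (((m : ℝ) - b) / 4) *
      twoPow (-(((1 : ℕ) : ℝ) / 2)) * 2 := by
    rw [← mul_one (twoPow _), ← twoPow_neg_one, ← mul_assoc]
    simp only [← twoPow_add]
    congr 2
    push_cast
    ring
  rw [h]
  rcases Nat.even_or_odd (weight (yellowMap B x.2.1)) with hk | hk
  · simp only [hk.neg_one_pow, Nat.not_odd_iff_even.mpr hk, and_false, if_false,
      Finset.prod_const_one]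
    ring
  · simp only [hk.neg_one_pow, hk, and_true]
    ring

/-! ### Subsets of positions and composites of yellow arrows. -/

lemma subsetWord_bijective (k : ℕ) :
    Function.Bijective fun s : Fin (2 ^ k) => Finset.univ.filter fun i => subsetWord s i = true := by
  refine (Fintype.bijective_iff_injective_and_card _).mpr ⟨fun s t h => ?_, by simp⟩
  refine finFunctionFinEquiv.symm.injective (funext fun i => ?_)
  have hi := Finset.ext_iff.mp h i
  simp only [subsetWord, Finset.mem_filter, Finset.mem_univ, true_and, decide_eq_true_eq] at hi
  omega

/-- Subsets of the positions, numbered by their binary digits. -/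
noncomputable def subsetEquiv (k : ℕ) : Fin (2 ^ k) ≃ Finset (Fin k) :=
  Equiv.ofBijective _ (subsetWord_bijective k)

lemma mem_subsetEquiv {k : ℕ} (s : Fin (2 ^ k)) (p : Fin k) :
    p ∈ subsetEquiv k s ↔ subsetWord s p = true := by
  simp [subsetEquiv]

lemma weight_subsetWord {k : ℕ} (s : Fin (2 ^ k)) :
    weight (subsetWord s) = (subsetEquiv k s).card := by
  congr 1

lemma yellowMap_eq_true_iff {m n : ℕ} (A : BMat m n) (x : Bits n) (i : Fin m) :
    yellowMap A x i = true ↔ ∀ j, A i j = true → x j = true :=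
  decide_eq_true_iff

lemma mul_eq_true_iff {l m n : ℕ} (A : BMat l m) (B : BMat m n) (i : Fin l) (k : Fin n) :
    A.mul B i k = true ↔ ∃ j, A i j = true ∧ B j k = true :=
  decide_eq_true_iff

lemma yellowMap_mul {l m n : ℕ} (A : BMat l m) (B : BMat m n) (x : Bits n) :
    yellowMap (A.mul B) x = yellowMap A (yellowMap B x) := by
  funext i
  rw [Bool.eq_iff_iff]
  simp only [yellowMap_eq_true_iff, mul_eq_true_iff]
  exact ⟨fun h j hj k hk => h k ⟨j, hj, hk⟩, fun h k ⟨j, hj, hk⟩ => h j hj k hk⟩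

lemma yellowMap_copiesI {m n : ℕ} (x : Bits n) (p : Fin (m * n)) :
    yellowMap (copiesI m n) x p = x p.modNat := by
  simp [yellowMap, copiesI]

lemma yellowMap_copiesJ {m n : ℕ} (x : Bits m) (p : Fin (m * n)) :
    yellowMap (copiesJ m n) x p = x p.divNat := by
  simp [yellowMap, copiesJ]

lemma yellowMap_Delta {k : ℕ} (x : Bits k) (s : Fin (2 ^ k)) :
    yellowMap (Delta k) x s = true ↔ ∀ p ∈ subsetEquiv k s, x p = true := by
  simp only [yellowMap_eq_true_iff, Delta, mem_subsetEquiv]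

/-! ### Parity as a sum over subsets, and the product of the `μ_s`. -/

/-- Expand `(-2 + 1)^|U|` by the binomial theorem, remove the empty subset's term `1`, and divide by
`-2`. Truncated subtraction is harmless, since `∅` is excluded. -/
lemma sum_neg_two_pow_card_erase_empty {ι : Type*} [DecidableEq ι] (U : Finset ι) :
    ∑ s ∈ U.powerset.erase ∅, (-2 : ℤ) ^ (s.card - 1) = if Odd U.card then 1 else 0 := by
  have h1 := Finset.sum_pow_mul_eq_add_pow (-2 : ℤ) 1 U
  rw [← Finset.add_sum_erase _ _ (Finset.empty_mem_powerset U)] at h1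
  have h2 : ∑ s ∈ U.powerset.erase ∅, (-2 : ℤ) ^ s.card * 1 ^ (U.card - s.card) =
      -2 * ∑ s ∈ U.powerset.erase ∅, (-2 : ℤ) ^ (s.card - 1) := by
    rw [Finset.mul_sum]
    refine Finset.sum_congr rfl fun s hs => ?_
    have : 0 < s.card :=
      Finset.card_pos.mpr (Finset.nonempty_iff_ne_empty.mpr (Finset.ne_of_mem_erase hs))
    rw [one_pow, mul_one, ← pow_succ', Nat.sub_add_cancel this]
  rw [h2] at h1
  rcases Nat.even_or_odd U.card with hk | hk
  · rw [if_neg (Nat.not_odd_iff_even.mpr hk)]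
    rw [show (-2 : ℤ) + 1 = -1 by norm_num, hk.neg_one_pow] at h1
    simp only [Finset.card_empty, pow_zero, one_pow, mul_one] at h1
    linarith
  · rw [if_pos hk]
    rw [show (-2 : ℤ) + 1 = -1 by norm_num, hk.neg_one_pow] at h1
    simp only [Finset.card_empty, pow_zero, one_pow, mul_one] at h1
    linarith

lemma prod_zpow_eq_zpow_sum {ι : Type*} {z : ℂ} (hz : z ≠ 0) (S : Finset ι) (f : ι → ℤ) :
    ∏ s ∈ S, z ^ f s = z ^ ∑ s ∈ S, f s := by
  classical
  induction S using Finset.induction_on with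
  | empty => simp
  | insert s S hs ih => rw [Finset.prod_insert hs, Finset.sum_insert hs, zpow_add₀ hz, ih]

lemma modNat_finProdFinEquiv {m n : ℕ} (q : Fin m × Fin n) :
    (finProdFinEquiv q).modNat = q.2 :=
  congrArg Prod.snd (finProdFinEquiv.symm_apply_apply q)

lemma divNat_finProdFinEquiv {m n : ℕ} (q : Fin m × Fin n) :
    (finProdFinEquiv q).divNat = q.1 :=
  congrArg Prod.fst (finProdFinEquiv.symm_apply_apply q)

lemma card_filter_block {n m : ℕ} (u : Bits n) (v : Bits m) (i : Fin n) :
    (Finset.univ.filter fun p : Fin (m * n) =>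
      (u p.modNat = true ∧ v p.divNat = true) ∧ p.modNat = i).card =
      if u i = true then weight v else 0 := by
  rw [Finset.card_filter, ← finProdFinEquiv.sum_comp, Fintype.sum_prod_type]
  simp only [modNat_finProdFinEquiv, divNat_finProdFinEquiv]
  rw [weight, Finset.card_filter, Finset.sum_comm, Finset.sum_eq_single i]
  · by_cases hu : u i = true <;> simp [hu]
  · intro j _ hj
    simp [hj]
  · simp

/-- The Fourier step: exchanging the products over `s` and `i` leaves, for each `i`, a power of `lam
i` whose exponent is a parity. Nonzero `lam i` lets the exponents, some negative, be added. -/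
lemma prod_mu {n m : ℕ} (u : Bits n) (v : Bits m) (lam rho : Fin n → ℂ)
    (h0 : ∀ i, lam i ≠ 0) :
    (∏ s, if yellowMap (Delta (m * n)) (yellowMap (copiesI m n) u) s = true ∧
        yellowMap (Delta (m * n)) (yellowMap (copiesJ m n) v) s = true
        then mu m lam rho s else 1) =
      muEmpty rho * ∏ i, if u i = true ∧ Odd (weight v) then lam i else 1 := by
  set T : Finset (Fin (m * n)) :=
    Finset.univ.filter fun p => u p.modNat = true ∧ v p.divNat = true with hT
  set c : Finset (Fin (m * n)) → ℂ := fun s =>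
    if s.card = 0 then muEmpty rho
    else ∏ i : Fin n, if ∀ p ∈ s, p.modNat = i then lam i ^ ((-2 : ℤ) ^ (s.card - 1)) else 1
    with hc
  calc
    _ = ∏ s, if subsetEquiv (m * n) s ∈ T.powerset then c (subsetEquiv (m * n) s) else 1 := by
      refine Finset.prod_congr rfl fun s _ => if_congr ?_ ?_ rfl
      · simp only [yellowMap_Delta, yellowMap_copiesI, yellowMap_copiesJ, Finset.mem_powerset,
          Finset.subset_iff, hT, Finset.mem_filter, Finset.mem_univ, true_and]
        exact ⟨fun h p hp => ⟨h.1 p hp, h.2 p hp⟩,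
          fun h => ⟨fun p hp => (h hp).1, fun p hp => (h hp).2⟩⟩
      · simp only [mu, hc, weight_subsetWord, mem_subsetEquiv, blockWord, decide_eq_true_eq]
    _ = ∏ s ∈ T.powerset, c s := by
      rw [(subsetEquiv (m * n)).prod_comp (fun s => if s ∈ T.powerset then c s else 1),
        Finset.prod_ite_mem, Finset.univ_inter]
    _ = muEmpty rho * ∏ s ∈ T.powerset.erase ∅, c s := by
      rw [← Finset.mul_prod_erase _ _ (Finset.empty_mem_powerset T)]
      simp [hc]
    _ = muEmpty rho * ∏ s ∈ T.powerset.erase ∅, ∏ i : Fin n,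
          if ∀ p ∈ s, p.modNat = i then lam i ^ ((-2 : ℤ) ^ (s.card - 1)) else 1 := by
      congr 1
      refine Finset.prod_congr rfl fun s hs => if_neg ?_
      exact fun h => Finset.ne_of_mem_erase hs (Finset.card_eq_zero.mp h)
    _ = _ := by
      rw [Finset.prod_comm]
      congr 1
      refine Finset.prod_congr rfl fun i _ => ?_
      rw [← Finset.prod_filter]
      -- The empty set lies vacuously in every fibre, so it has to be split off before sorting
      -- subsets by fibre.
      have hU : (T.powerset.erase ∅).filter (fun s => ∀ p ∈ s, p.modNat = i) =
          (T.filter fun p => p.modNat = i).powerset.erase ∅ := by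
        ext s
        simp only [Finset.mem_filter, Finset.mem_erase, Finset.mem_powerset,
          Finset.subset_iff]
        grind
      rw [hU, prod_zpow_eq_zpow_sum (h0 i), sum_neg_two_pow_card_erase_empty, hT,
        Finset.filter_filter, card_filter_block]
      by_cases hu : u i = true <;> by_cases hv : Odd (weight v) <;> simp [hu, hv]

/-- For fixed `i` with `u i = true`, the product over the blocks is `(-1) ^ weight v`. -/
lemma prod_pairs_neg_one {n m : ℕ} (u : Bits n) (v : Bits m) :
    (∏ p : Fin (m * n), if u p.modNat = true ∧ v p.divNat = true then (-1 : ℂ) else 1) =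
      ∏ i, if u i = true ∧ Odd (weight v) then -1 else 1 := by
  rw [← finProdFinEquiv.prod_comp, Fintype.prod_prod_type, Finset.prod_comm]
  simp only [modNat_finProdFinEquiv, divNat_finProdFinEquiv]
  refine Finset.prod_congr rfl fun i _ => ?_
  by_cases hu : u i = true
  · simp only [hu, true_and]
    rw [prod_neg_one_of_bits]
    split_ifs with hv
    · exact hv.neg_one_pow
    · exact (Nat.not_odd_iff_even.mp hv).neg_one_pow
  · simp [hu]

lemma fourier_equal {a b n m : ℕ} (A : BMat n a) (B : BMat m b) (lam rho : Fin n → ℂ)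
    (h0 : ∀ i, lam i ≠ 0) :
    Diagram.Equal (fourierLhs A B lam rho) (fourierRhs A B lam rho) := by
  funext y x
  rw [fourierLhs, interp_scalarBox_par, interp_pivotLhs, fourierRhs, interp_arrowsBox, matC,
    matD]
  simp only [yellowMap_mul]
  rw [prod_mu _ _ _ _ h0]
  ring

lemma pivotLhs_neg_one_equal {a b n m : ℕ} (A : BMat n a) (B : BMat m b) :
    Diagram.Equal (pivotLhs A B (fun _ => -1)) (regularRhs A B) := by
  funext y x
  rw [interp_pivotLhs, regularRhs, interp_arrowsBox]
  simp only [yellowMap_mul, yellowMap_copiesI, yellowMap_copiesJ, prod_pairs_neg_one]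

end SZH

theorem mainTheorem1 {a b n m : ℕ} (A : SZH.BMat n a) (B : SZH.BMat m b) :
    (∀ lam rho : Fin n → ℂ, (∀ i, lam i ≠ 0) → (∀ i, rho i ^ 2 = lam i) →
      SZH.Diagram.Equal (SZH.fourierLhs A B lam rho) (SZH.fourierRhs A B lam rho)) ∧
    (∀ rho : Fin n → ℂ, (∀ i, rho i ^ 2 = -1) →
      SZH.Diagram.Equal (SZH.fourierRhs A B (fun _ => -1) rho)
        (.par (SZH.scalarBox (SZH.muEmpty rho)) (SZH.regularRhs A B))) ∧
    SZH.Diagram.Equal (SZH.pivotLhs A B (fun _ => -1)) (SZH.regularRhs A B) := by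
  refine ⟨fun lam rho h0 _ => SZH.fourier_equal A B lam rho h0, fun rho _ => ?_,
    SZH.pivotLhs_neg_one_equal A B⟩
  -- Both right-hand sides are compared through the pivot with all parameters `-1`.
  refine (SZH.fourier_equal A B _ rho fun _ => neg_ne_zero.mpr one_ne_zero).symm.trans ?_
  funext y x
  rw [SZH.fourierLhs, SZH.interp_scalarBox_par, SZH.interp_scalarBox_par]
  exact congrArg (SZH.muEmpty rho * ·)
    (congrFun (congrFun (SZH.pivotLhs_neg_one_equal A B) y) x)
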